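/- Conventions. A poset is $\mu$-directed ($\mu$ a regular cardinal) if each of its subsets of cardinality $<\mu$ has an upper bound; directed means $\aleph_0$-directed; a $\mu$-directed colimit is the colimit of a diagram indexed by a (small) $\mu$-directed poset. An object $M$ of a category $\mathcal K$ is $\mu$-presentable if $\mathrm{Hom}_{\mathcal K}(M,-)$ preserves $\mu$-directed colimits; for an infinite cardinal $\lambda$, $M$ is $(<\lambda)$-presentable if it is $\theta$-presentable for some regular $\theta<\lambda+\aleph_1$. The presentability rank of $M$ is the least regular cardinal $\mu$ such that $M$ is $\mu$-presentable (if there is one). A (locally small) category $\mathcal K$ is $\mu$-accessible if it has $\mu$-directed colimits, has only a set of $\mu$-presentable objects up to isomorphism, and each of its objects is a $\mu$-directed colimit of $\mu$-presentable objects; finitely accessible means $\aleph_0$-accessible. An object $M$ is filtrable if it has a presentability rank $\kappa$ and there are a regular cardinal $\mu<\kappa$ and a diagram $\langle M_i : i<\mu\rangle$ in $\mathcal K$ indexed by the ordinal $\mu$, with all $M_i$ $(<\kappa)$-presentable, whose colimit is $M$. For a regular cardinal $\kappa$, $\mathcal K$ is $\kappa$-filtrable if every object of presentability rank $\kappa$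 is filtrable, and almost $\kappa$-filtrable if for every object $M$ of presentability rank $\kappa$ there is a split epimorphism $N\to M$ from a filtrable $\kappa$-presentable object $N$. For a regular cardinal $\mu$, $\mathcal K$ is (almost) well $\mu$-filtrable if it is (almost) $\kappa$-filtrable for every regular cardinal $\kappa\ge\mu$. Statement. Let $\lambda$ be a regular cardinal. (1) Every finitely accessible category is well $\aleph_1$-filtrable. (2) Every $\lambda$-accessible category with directed colimits is almost well $\lambda^+$-filtrable. (3) Every $\lambda$-accessible category with directed colimits in which all morphisms are monomorphisms is well $\lambda^+$-filtrable. -/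

import Mathlib

open CategoryTheory CategoryTheory.Limits Cardinal

universe w v u

namespace Filtrations

variable {C : Type u} [Category.{v} C]

/-- `X` is `κ`-presentable; this includes that the cardinal `κ` is regular. -/
def IsPresentableAt (X : C) (κ : Cardinal.{w}) : Prop :=
  ∃ _ : Fact κ.IsRegular, IsCardinalPresentable X κ

/-- `X` is `(<κ)`-presentable: it is `θ`-presentable for some regular `θ < κ + ℵ₁`. -/
def IsLTPresentable (X : C) (κ : Cardinal.{w}) : Prop :=
  ∃ θ : Cardinal.{w}, θ < κ + ℵ₁ ∧ IsPresentableAt X θ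

/-- `κ` is the presentability rank of `X`: the least regular cardinal `κ` such that
`X` is `κ`-presentable. -/
def HasPresentabilityRank (X : C) (κ : Cardinal.{w}) : Prop :=
  IsLeast {θ : Cardinal.{w} | IsPresentableAt X θ} κ

/-- A `(μ, <κ)`-chain: a diagram indexed by the cardinal `μ` (seen as an ordinal), all of whose
objects are `(<κ)`-presentable. -/
def IsLTChain (μ κ : Cardinal.{w}) (F : μ.ord.ToType ⥤ C) : Prop :=
  ∀ i : μ.ord.ToType, IsLTPresentable (F.obj i) κ

/-- `X` has a presentability rank `κ` and is the colimit of a `(μ, <κ)`-chain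
for some regular cardinal `μ < κ`. -/
def IsFiltrable (X : C) : Prop :=
  ∃ κ : Cardinal.{w}, HasPresentabilityRank X κ ∧
    ∃ μ : Cardinal.{w}, μ.IsRegular ∧ μ < κ ∧
      ∃ P : ColimitPresentation μ.ord.ToType X, IsLTChain μ κ P.diag

variable (C)

/-- Every object of presentability rank `κ` is filtrable. -/
def IsFiltrableCategory (κ : Cardinal.{w}) : Prop :=
  ∀ X : C, HasPresentabilityRank X κ → IsFiltrable.{w} X

/-- Every object of presentability rank `κ` is a retract of a filtrable `κ`-presentable object. -/
def IsAlmostFiltrableCategory (κ : Cardinal.{w}) : Prop :=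
  ∀ X : C, HasPresentabilityRank X κ →
    ∃ N : C, IsFiltrable.{w} N ∧ IsPresentableAt N κ ∧ ∃ p : N ⟶ X, IsSplitEpi p

def IsWellFiltrableCategory (μ : Cardinal.{w}) : Prop :=
  ∀ κ : Cardinal.{w}, κ.IsRegular → μ ≤ κ → IsFiltrableCategory C κ

def IsAlmostWellFiltrableCategory (μ : Cardinal.{w}) : Prop :=
  ∀ κ : Cardinal.{w}, κ.IsRegular → μ ≤ κ → IsAlmostFiltrableCategory C κ

/-- `C` has colimits of all diagrams indexed by (nonempty, small) directed posets. -/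
def HasDirectedColimits : Prop :=
  ∀ (J : Type w) [PartialOrder J] [IsDirectedOrder J] [Nonempty J], HasColimitsOfShape J C

end Filtrations

/-! Let `X` have rank `κ > λ`, and write `X` as a directed colimit of `λ`-presentable objects over a
poset `J`. Since `κ` is uncountable, `J` is the `κ`-directed union of its directed subsets of size
`< κ`, so the identity of `X` factors through the colimit `N` over one such subset `S`
(`exists_section_subsetColimit`). Thus `X` is a retract of `N`, and `N` has rank exactly `κ`. An
infinite directed poset is the union of a chain of smaller directed subsets of regular length
(`exists_directed_chain`); the colimits over these filter `N` (`isFiltrable_of_isColimit`). This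
gives (2).

In (3) the split epimorphism is monic, hence invertible. In (1), finite presentability allows `S` to
be enlarged until its colimit is `X` itself (`exists_isColimit_restrictCocone`). -/

namespace Filtrations

/-! ### Chains of directed subsets of a directed preorder. -/

section Combinatorics

variable {I : Type w}

/-- The finite stages of the closure of a set under a binary operation. -/
def opClosureStage (m : I → I → I) (S : Set I) : ℕ → Set I
  | 0 => S
  | n + 1 => opClosureStage m S n ∪ Set.image2 m (opClosureStage m S n) (opClosureStage m S n)

/-- The closure of a set under a binary operation. -/
def opClosure (m : I → I → I) (S : Set I) : Set I := ⋃ n, opClosureStage m S n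

lemma opClosureStage_monotone (m : I → I → I) (S : Set I) : Monotone (opClosureStage m S) :=
  monotone_nat_of_le_succ fun _ ↦ Set.subset_union_left

lemma subset_opClosure (m : I → I → I) (S : Set I) : S ⊆ opClosure m S :=
  Set.subset_iUnion (opClosureStage m S) 0

lemma opClosure_mem (m : I → I → I) (S : Set I) {a b : I} (ha : a ∈ opClosure m S)
    (hb : b ∈ opClosure m S) : m a b ∈ opClosure m S := by
  obtain ⟨n, hn⟩ := Set.mem_iUnion.1 ha
  obtain ⟨k, hk⟩ := Set.mem_iUnion.1 hb
  exact Set.mem_iUnion.2 ⟨max n k + 1, Or.inr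
    ⟨a, opClosureStage_monotone m S (le_max_left n k) hn,
      b, opClosureStage_monotone m S (le_max_right n k) hk, rfl⟩⟩

lemma opClosure_mono (m : I → I → I) : Monotone (opClosure m) := by
  intro S T h
  refine Set.iUnion_mono fun n ↦ ?_
  induction n with
  | zero => exact h
  | succ n ih => exact Set.union_subset_union ih (Set.image2_subset ih ih)

lemma mk_opClosure_le (m : I → I → I) (S : Set I) : #(opClosure m S) ≤ max ℵ₀ #S := by
  have hstage (n : ℕ) : #(opClosureStage m S n) ≤ max ℵ₀ #S := by
    induction n with
    | zero => exact le_max_right _ _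
    | succ n ih =>
      refine (mk_union_le _ _).trans ?_
      refine add_le_of_le (le_max_left _ _) ih (mk_image2_le.trans ?_)
      exact mul_le_of_le (le_max_left _ _) ih ih
  have h := mk_iUnion_le_lift (opClosureStage m S)
  rw [Cardinal.lift_id'.{0, w}] at h
  simp only [Cardinal.lift_id'.{0, w}] at h
  refine h.trans (mul_le_of_le (le_max_left _ _) (by simp) (ciSup_le' hstage))

lemma hasCardinalLT_opClosure (m : I → I → I) (S : Set I) {κ : Cardinal.{w}} (hκ : ℵ₀ < κ)
    (hS : HasCardinalLT S κ) : HasCardinalLT (opClosure m S) κ := by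
  rw [hasCardinalLT_iff_cardinal_mk_lt] at hS ⊢
  exact (mk_opClosure_le m S).trans_lt (max_lt hκ hS)

lemma directedOn_opClosure [Preorder I] {m : I → I → I} (hl : ∀ a b, a ≤ m a b)
    (hr : ∀ a b, b ≤ m a b) (S : Set I) : DirectedOn (· ≤ ·) (opClosure m S) :=
  fun a ha b hb ↦ ⟨m a b, opClosure_mem m S ha hb, hl a b, hr a b⟩

lemma exists_upper_bound_op (I : Type w) [Preorder I] [IsDirectedOrder I] :
    ∃ m : I → I → I, (∀ a b, a ≤ m a b) ∧ ∀ a b, b ≤ m a b := by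
  choose m hm using fun a b : I ↦ exists_ge_ge a b
  exact ⟨m, fun a b ↦ (hm a b).1, fun a b ↦ (hm a b).2⟩

/-- Closing a finite set under a binary operation may give a countably infinite set, so the
countable case needs its own construction: each piece is finite and directed because it has a
greatest element. -/
lemma exists_countable_directed_chain (I : Type w) [Preorder I] [IsDirectedOrder I]
    (f : ℕ → I) (hf : Function.Surjective f) :
    ∃ A : ℕ → Set I, Monotone A ∧
      (∀ n, DirectedOn (· ≤ ·) (A n) ∧ (A n).Nonempty ∧ (A n).Finite) ∧ ⋃ n, A n = Set.univ := by
  obtain ⟨m, hl, hr⟩ := exists_upper_bound_op I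
  -- An increasing sequence with `b n` above `f 0, ..., f n`.
  let b : ℕ → I := fun n ↦ Nat.rec (f 0) (fun k x ↦ m x (f (k + 1))) n
  have hb : Monotone b := monotone_nat_of_le_succ fun n ↦ hl _ _
  have hfb (n : ℕ) : f n ≤ b n := by
    cases n with
    | zero => exact le_rfl
    | succ n => exact hr _ _
  refine ⟨fun n ↦ f '' Set.Iic n ∪ b '' Set.Iic n, fun n k h ↦ ?_, fun n ↦ ⟨?_, ?_, ?_⟩, ?_⟩
  · have := Set.Iic_subset_Iic.2 h
    exact Set.union_subset_union (Set.image_mono this) (Set.image_mono this)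
  · have hle : ∀ x ∈ f '' Set.Iic n ∪ b '' Set.Iic n, x ≤ b n := by
      rintro _ (⟨k, hk, rfl⟩ | ⟨k, hk, rfl⟩)
      · exact (hfb k).trans (hb hk)
      · exact hb hk
    exact fun x hx y hy ↦ ⟨b n, Or.inr ⟨n, Set.self_mem_Iic, rfl⟩, hle x hx, hle y hy⟩
  · exact ⟨b n, Or.inr ⟨n, Set.self_mem_Iic, rfl⟩⟩
  · exact ((Set.finite_Iic n).image f).union ((Set.finite_Iic n).image b)
  · refine Set.eq_univ_of_forall fun x ↦ ?_
    obtain ⟨n, rfl⟩ := hf x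
    exact Set.mem_iUnion.2 ⟨n, Or.inl ⟨n, Set.self_mem_Iic, rfl⟩⟩

lemma mk_Iic_toType_ord_lt {θ : Cardinal.{w}} (hθ : ℵ₀ ≤ θ) (t : θ.ord.ToType) :
    #(Set.Iic t) < θ := by
  have := Cardinal.noMaxOrder hθ
  have h : #(Set.Iio (Order.succ t)) < #θ.ord.ToType := mk_Iio_lt _ (by simp)
  rw [Order.Iio_succ] at h
  simpa using h

/-- An infinite directed preorder of cardinality `θ` is the union of an increasing family, indexed
by `θ`, of directed subsets of smaller cardinality. -/
lemma exists_directed_chain_ord (I : Type w) [Preorder I] [IsDirectedOrder I] [Infinite I] :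
    ∃ A : (#I).ord.ToType → Set I, Monotone A ∧
      (∀ t, DirectedOn (· ≤ ·) (A t) ∧ (A t).Nonempty ∧ #(A t) < #I) ∧ ⋃ t, A t = Set.univ := by
  have hθ : ℵ₀ ≤ #I := aleph0_le_mk I
  obtain ⟨f⟩ : Nonempty ((#I).ord.ToType ≃ I) := Cardinal.eq.1 (by simp)
  obtain h | h := hθ.eq_or_lt
  · obtain ⟨e⟩ : Nonempty ((· < · : (#I).ord.ToType → (#I).ord.ToType → Prop) ≃r
        (· < · : ℕ → ℕ → Prop)) := by
      rw [← Ordinal.lift_type_eq.{w, 0, 0}]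
      simp [← h]
    let e' := OrderIso.ofRelIsoLT e
    obtain ⟨A, hA, hA', hA''⟩ := exists_countable_directed_chain I (fun n ↦ f (e'.symm n))
      (f.surjective.comp e'.symm.surjective)
    refine ⟨fun t ↦ A (e' t), hA.comp e'.monotone, fun t ↦ ⟨(hA' _).1, (hA' _).2.1, ?_⟩, ?_⟩
    · exact ((hA' _).2.2.lt_aleph0).trans_le hθ
    · rw [← hA'']
      exact e'.surjective.iUnion_comp A
  · obtain ⟨m, hl, hr⟩ := exists_upper_bound_op I
    refine ⟨fun t ↦ opClosure m (f '' Set.Iic t), fun s t hst ↦ ?_, fun t ↦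
      ⟨directedOn_opClosure hl hr _, ?_, ?_⟩, ?_⟩
    · exact opClosure_mono m (Set.image_mono (Set.Iic_subset_Iic.2 hst))
    · exact ⟨f t, subset_opClosure _ _ ⟨t, Set.self_mem_Iic, rfl⟩⟩
    · exact (mk_opClosure_le _ _).trans_lt
        (max_lt h (mk_image_le.trans_lt (mk_Iic_toType_ord_lt hθ t)))
    · refine Set.eq_univ_of_forall fun x ↦ ?_
      obtain ⟨t, rfl⟩ := f.surjective x
      exact Set.mem_iUnion.2 ⟨t, subset_opClosure _ _ ⟨t, Set.self_mem_Iic, rfl⟩⟩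

/-- An infinite directed preorder is the union of an increasing chain of directed subsets of
smaller cardinality; the length of the chain is the cofinality of its cardinality. -/
lemma exists_directed_chain (I : Type w) [Preorder I] [IsDirectedOrder I] [Infinite I] :
    ∃ A : (#I).ord.cof.ord.ToType → Set I, Monotone A ∧
      (∀ t, DirectedOn (· ≤ ·) (A t) ∧ (A t).Nonempty ∧ #(A t) < #I) ∧ ⋃ t, A t = Set.univ := by
  obtain ⟨A, hA, hA', hA''⟩ := exists_directed_chain_ord I
  -- Filtrability demands a regular length, whereas `#I` may be singular; a cofinal subsequence of
  -- length the cofinality still covers `I`.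
  obtain ⟨g, hg⟩ := Ordinal.exists_isFundamentalSeq (o := (#I).ord) rfl
  refine ⟨fun t ↦ A (Ordinal.ToType.mk (g (Ordinal.ToType.mk.symm t))), fun s t hst ↦ ?_,
    fun t ↦ hA' _, ?_⟩
  · exact hA (Ordinal.ToType.mk.monotone
      (hg.strictMono.monotone (Ordinal.ToType.mk.symm.monotone hst)))
  · refine Set.eq_univ_of_forall fun x ↦ ?_
    obtain ⟨t, ht⟩ := Set.mem_iUnion.1 (hA''.symm ▸ Set.mem_univ x)
    obtain ⟨_, ⟨s, rfl⟩, hs⟩ := hg.isCofinal_range (Ordinal.ToType.mk.symm t)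
    refine Set.mem_iUnion.2 ⟨Ordinal.ToType.mk s, hA ?_ ht⟩
    rw [OrderIso.symm_apply_apply, ← OrderIso.symm_apply_le]
    exact hs

end Combinatorics

/-! ### Decomposing a colimit along a directed cover of its index. -/

section SubsetColimits

variable {C : Type u} [Category.{v} C] {J : Type w} [Preorder J]

/-- The restriction of a diagram indexed by a preorder to a subset. -/
abbrev restrictDiagram (D : J ⥤ C) (S : Set J) : S ⥤ C where
  obj x := D.obj x.1
  map f := D.map (homOfLE (leOfHom f))
  map_id _ := D.map_id _
  map_comp _ _ := D.map_comp _ _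

/-- The restriction of a cocone to a subset of the indexing preorder. -/
abbrev restrictCocone {D : J ⥤ C} (c : Cocone D) (S : Set J) : Cocone (restrictDiagram D S) where
  pt := c.pt
  ι :=
    { app x := c.ι.app x.1
      naturality _ _ _ := c.ι.naturality _ }

/-- The colimit of a diagram restricted to a subset. -/
noncomputable def subsetColimit (D : J ⥤ C) (S : Set J) [HasColimit (restrictDiagram D S)] : C :=
  colimit (restrictDiagram D S)

section

variable (D : J ⥤ C) (S : Set J) [HasColimit (restrictDiagram D S)]

/-- The maps to the colimit of a diagram restricted to a subset. -/
noncomputable def subsetColimitι (j : J) (hj : j ∈ S) : D.obj j ⟶ subsetColimit D S :=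
  colimit.ι (restrictDiagram D S) ⟨j, hj⟩

/-- The colimit cocone of a diagram restricted to a subset. -/
noncomputable abbrev subsetCocone : Cocone (restrictDiagram D S) where
  pt := subsetColimit D S
  ι :=
    { app x := subsetColimitι D S x.1 x.2
      naturality _ _ f := (colimit.cocone (restrictDiagram D S)).ι.naturality f }

/-- The cocone `subsetCocone D S` is a colimit. -/
noncomputable def isColimitSubsetCocone : IsColimit (subsetCocone D S) :=
  colimit.isColimit (restrictDiagram D S)

lemma map_subsetColimitι {i j : J} (f : i ⟶ j) (hi : i ∈ S) (hj : j ∈ S) :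
    D.map f ≫ subsetColimitι D S j hj = subsetColimitι D S i hi :=
  colimit.w (restrictDiagram D S) (homOfLE (leOfHom f) : (⟨i, hi⟩ : S) ⟶ ⟨j, hj⟩)

variable {D S} in
lemma subsetColimit_hom_ext {Z : C} {f g : subsetColimit D S ⟶ Z}
    (h : ∀ j hj, subsetColimitι D S j hj ≫ f = subsetColimitι D S j hj ≫ g) : f = g :=
  colimit.hom_ext fun x ↦ h x.1 x.2

variable {D} in
/-- The map from the colimit of a restricted diagram to a cocone on the whole diagram. -/
noncomputable def subsetColimitDesc (c : Cocone D) : subsetColimit D S ⟶ c.pt :=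
  colimit.desc (restrictDiagram D S) (restrictCocone c S)

variable {D} in
lemma ι_subsetColimitDesc (c : Cocone D) (j : J) (hj : j ∈ S) :
    subsetColimitι D S j hj ≫ subsetColimitDesc S c = c.ι.app j :=
  colimit.ι_desc (restrictCocone c S) ⟨j, hj⟩

variable {S} {T : Set J} [HasColimit (restrictDiagram D T)] (h : S ⊆ T)

/-- The map between colimits of restrictions of a diagram induced by an inclusion. -/
noncomputable def subsetColimitMap : subsetColimit D S ⟶ subsetColimit D T :=
  (isColimitSubsetCocone D S).desc
    { pt := subsetColimit D T
      ι :=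
        { app x := subsetColimitι D T x.1 (h x.2)
          naturality x y f :=
            (map_subsetColimitι D T (homOfLE (leOfHom f)) (h x.2) (h y.2)).trans
              (Category.comp_id _).symm } }

lemma ι_subsetColimitMap (j : J) (hj : j ∈ S) :
    subsetColimitι D S j hj ≫ subsetColimitMap D h = subsetColimitι D T j (h hj) :=
  (isColimitSubsetCocone D S).fac _ ⟨j, hj⟩

lemma subsetColimitMap_desc (c : Cocone D) :
    subsetColimitMap D h ≫ subsetColimitDesc T c = subsetColimitDesc S c :=
  subsetColimit_hom_ext fun j hj ↦ by
    rw [← Category.assoc, ι_subsetColimitMap, ι_subsetColimitDesc, ι_subsetColimitDesc]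

end

variable {K : Type w} [Preorder K] (D : J ⥤ C) {A : K → Set J} (hA : Monotone A)
  [∀ k, HasColimit (restrictDiagram D (A k))]

/-- The functor sending `k` to the colimit of `D` restricted to `A k`. -/
noncomputable abbrev subsetColimitFunctor : K ⥤ C where
  obj k := subsetColimit D (A k)
  map f := subsetColimitMap D (hA (leOfHom f))
  map_id k := subsetColimit_hom_ext fun j hj ↦ by
    rw [ι_subsetColimitMap, Category.comp_id]
  map_comp f g := subsetColimit_hom_ext fun j hj ↦ by
    rw [ι_subsetColimitMap, ← Category.assoc, ι_subsetColimitMap, ι_subsetColimitMap]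

/-- The colimits of `D` over subsets of `J` map to any cocone over `D`. -/
noncomputable abbrev subsetColimitCocone (c : Cocone D) :
    Cocone (subsetColimitFunctor D hA) where
  pt := c.pt
  ι :=
    { app k := subsetColimitDesc (A k) c
      naturality _ _ f := (subsetColimitMap_desc D (hA (leOfHom f)) c).trans
        (Category.comp_id _).symm }

/-- A colimit over `J` is the colimit of the colimits over the members of a directed family of
subsets covering `J`. -/
lemma nonempty_isColimit_subsetColimitCocone [IsDirectedOrder K] (hA' : ⋃ k, A k = Set.univ)
    {c : Cocone D} (hc : IsColimit c) : Nonempty (IsColimit (subsetColimitCocone D hA c)) := by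
  have hmem (j : J) : ∃ k, j ∈ A k := Set.mem_iUnion.1 (hA'.symm ▸ Set.mem_univ j)
  choose k hk using hmem
  let α (s : Cocone (subsetColimitFunctor D hA)) (l : K) : subsetColimit D (A l) ⟶ s.pt :=
    s.ι.app l
  have hα (s : Cocone (subsetColimitFunctor D hA)) {l l' : K} (h : l ≤ l') :
      subsetColimitMap D (hA h) ≫ α s l' = α s l := s.w (homOfLE h)
  have hle (s : Cocone (subsetColimitFunctor D hA)) (j : J) {l l' : K} (h : l ≤ l')
      (hj : j ∈ A l) : subsetColimitι D (A l) j hj ≫ α s l =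
        subsetColimitι D (A l') j (hA h hj) ≫ α s l' := by
    rw [← hα s h, ← Category.assoc, ι_subsetColimitMap]
  -- Since `K` is directed, the component at `j` does not depend on which `A k` containing `j` is
  -- used, so the chosen indices need no compatibility.
  have key (s : Cocone (subsetColimitFunctor D hA)) (j : J) {k₁ k₂ : K} (h₁ : j ∈ A k₁)
      (h₂ : j ∈ A k₂) : subsetColimitι D (A k₁) j h₁ ≫ α s k₁ =
        subsetColimitι D (A k₂) j h₂ ≫ α s k₂ := by
    obtain ⟨l, hl₁, hl₂⟩ := exists_ge_ge k₁ k₂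
    rw [hle s j hl₁, hle s j hl₂]
  have hnat (s : Cocone (subsetColimitFunctor D hA)) {i j : J} (f : i ⟶ j) :
      D.map f ≫ subsetColimitι D (A (k j)) j (hk j) ≫ α s (k j) =
        subsetColimitι D (A (k i)) i (hk i) ≫ α s (k i) := by
    obtain ⟨l, hl₁, hl₂⟩ := exists_ge_ge (k i) (k j)
    rw [hle s i hl₁, hle s j hl₂, ← Category.assoc,
      map_subsetColimitι D (A l) f (hA hl₁ (hk i)) (hA hl₂ (hk j))]
  let t (s : Cocone (subsetColimitFunctor D hA)) : Cocone D :=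
    { pt := s.pt
      ι :=
        { app j := subsetColimitι D (A (k j)) j (hk j) ≫ α s (k j)
          naturality _ _ f := (hnat s f).trans (Category.comp_id _).symm } }
  refine ⟨{ desc := fun s ↦ hc.desc (t s), fac := fun s l ↦ ?_, uniq := fun s g hg ↦ ?_ }⟩
  · refine subsetColimit_hom_ext fun j hj ↦ ?_
    refine (Category.assoc _ _ _).symm.trans ?_
    refine (congrArg (· ≫ hc.desc (t s)) (ι_subsetColimitDesc (A l) c j hj)).trans ?_
    exact (hc.fac (t s) j).trans (key s j _ hj)
  · refine hc.hom_ext fun j ↦ (Eq.trans ?_ (hc.fac (t s) j).symm)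
    refine (congrArg (· ≫ g) (ι_subsetColimitDesc (A (k j)) c j (hk j)).symm).trans ?_
    exact (Category.assoc _ _ _).trans (congrArg (subsetColimitι D (A (k j)) j (hk j) ≫ ·)
      (hg (k j)))

end SubsetColimits

/-! ### Presentability of directed colimits, retracts and filtrations. -/

section Presentability

variable {C : Type u} [Category.{v} C]

lemma hasCardinalLT_arrow_preorder {J : Type w} [Preorder J] {κ : Cardinal.{w}} (hκ : ℵ₀ ≤ κ)
    (hJ : HasCardinalLT J κ) : HasCardinalLT (Arrow J) κ :=
  (hasCardinalLT_prod hκ hJ hJ).of_injective (fun f : Arrow J ↦ (f.left, f.right)) (by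
    rintro ⟨a, b, f⟩ ⟨a', b', f'⟩ h
    obtain ⟨rfl, rfl⟩ := Prod.ext_iff.1 h
    obtain rfl : f = f' := Subsingleton.elim _ _
    rfl)

lemma IsPresentableAt.mono {X : C} {θ κ : Cardinal.{w}} (h : IsPresentableAt X θ)
    (hκ : κ.IsRegular) (hle : θ ≤ κ) : IsPresentableAt X κ := by
  obtain ⟨_, _⟩ := h
  have : Fact κ.IsRegular := ⟨hκ⟩
  exact ⟨inferInstance, isCardinalPresentable_of_le X hle⟩

lemma IsPresentableAt.of_retract {X Y : C} {θ : Cardinal.{w}} (h : IsPresentableAt Y θ)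
    (r : Retract X Y) : IsPresentableAt X θ := by
  obtain ⟨_, _⟩ := h
  exact ⟨inferInstance, r.isCardinalPresentable θ⟩

lemma isPresentableAt_of_isColimit [LocallySmall.{w} C] {J : Type w} [Preorder J] {D : J ⥤ C}
    {c : Cocone D} (hc : IsColimit c) {lam κ : Cardinal.{w}} (hκ : κ.IsRegular) (hle : lam ≤ κ)
    (hJ : HasCardinalLT J κ) (hD : ∀ j, IsPresentableAt (D.obj j) lam) :
    IsPresentableAt c.pt κ := by
  have : Fact κ.IsRegular := ⟨hκ⟩
  have (j : J) : IsCardinalPresentable (D.obj j) κ := ((hD j).mono hκ hle).2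
  exact ⟨inferInstance, isCardinalPresentable_of_isColimit c hc κ
    (hasCardinalLT_arrow_preorder hκ.aleph0_le hJ)⟩

lemma IsFiltrable.of_iso {X Y : C} (h : IsFiltrable.{w} X) (e : X ≅ Y) : IsFiltrable.{w} Y := by
  obtain ⟨κ, hκ, μ, hμ, hlt, P, hP⟩ := h
  exact ⟨κ, ⟨hκ.1.of_retract (Retract.ofIso e.symm),
    fun θ hθ ↦ hκ.2 (hθ.of_retract (Retract.ofIso e))⟩, μ, hμ, hlt, P.ofIso e, hP⟩

/-- An object whose presentability rank is `κ` and which is a directed colimit, of size `< κ`, of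
objects presentable below `κ`, is filtrable. -/
lemma isFiltrable_of_isColimit [LocallySmall.{w} C] (hC : HasDirectedColimits.{w} C)
    {J : Type w} [PartialOrder J] [IsDirectedOrder J] {D : J ⥤ C} {c : Cocone D}
    (hc : IsColimit c) {lam κ : Cardinal.{w}} (hlam : lam.IsRegular) (hlt : lam < κ)
    (hJ : HasCardinalLT J κ) (hD : ∀ j, IsPresentableAt (D.obj j) lam)
    (hκ : HasPresentabilityRank c.pt κ) : IsFiltrable.{w} c.pt := by
  rw [hasCardinalLT_iff_cardinal_mk_lt] at hJ
  -- If `J` were smaller than `lam`, the colimit would be `lam`-presentable, contradicting its rank.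
  have hle : lam ≤ #J := by
    by_contra! h
    exact hlt.not_ge (hκ.2 (isPresentableAt_of_isColimit hc hlam le_rfl
      (by rwa [hasCardinalLT_iff_cardinal_mk_lt]) hD))
  have hinf : ℵ₀ ≤ #J := hlam.aleph0_le.trans hle
  have : Infinite J := infinite_iff.2 hinf
  obtain ⟨A, hA, hA', hA''⟩ := exists_directed_chain J
  have (t : (#J).ord.cof.ord.ToType) : HasColimit (restrictDiagram D (A t)) := by
    have := (hA' t).1.isDirectedOrder
    have := (hA' t).2.1.to_subtype
    have := hC (A t)
    infer_instance
  obtain ⟨hcol⟩ := nonempty_isColimit_subsetColimitCocone D hA hA'' hc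
  refine ⟨κ, hκ, (#J).ord.cof, isRegular_cof (isSuccLimit_ord hinf),
    (Ordinal.cof_ord_le _).trans_lt hJ, ⟨_, _, hcol⟩, fun t ↦ ?_⟩
  -- The larger of `lam` and the successor of `#(A t)` works: that successor is at most `#J < κ`.
  obtain ⟨θ, hθ, hθ', hθκ, hθA⟩ : ∃ θ : Cardinal.{w}, θ.IsRegular ∧ lam ≤ θ ∧ θ < κ ∧
      #(A t) < θ := by
    obtain h | h := lt_or_ge #(A t) lam
    · exact ⟨lam, hlam, le_rfl, hlt, h⟩
    · exact ⟨Order.succ #(A t), isRegular_succ (hlam.aleph0_le.trans h),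
        h.trans (Order.le_succ _), (Order.succ_le_of_lt (hA' t).2.2).trans_lt hJ, Order.lt_succ _⟩
  exact ⟨θ, hθκ.trans_le (self_le_add_right _ _), isPresentableAt_of_isColimit
    (isColimitSubsetCocone D (A t)) hθ hθ'
    (by rwa [hasCardinalLT_iff_cardinal_mk_lt]) (fun _ ↦ hD _)⟩

/-- A `κ`-presentable directed colimit is a retract of the colimit over a directed subset of
cardinality `< κ`. -/
lemma exists_section_subsetColimit (hC : HasDirectedColimits.{w} C)
    {J : Type w} [PartialOrder J] [IsDirectedOrder J] [Nonempty J] {D : J ⥤ C} {c : Cocone D}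
    (hc : IsColimit c) {κ : Cardinal.{w}} (hκ : ℵ₀ < κ) (hX : IsPresentableAt c.pt κ) :
    ∃ (S : Set J) (_ : DirectedOn (· ≤ ·) S) (_ : S.Nonempty) (_ : HasCardinalLT S κ)
      (_ : HasColimit (restrictDiagram D S)) (s : c.pt ⟶ subsetColimit D S),
      s ≫ subsetColimitDesc S c = 𝟙 c.pt := by
  obtain ⟨_, _⟩ := hX
  have hreg : κ.IsRegular := Fact.out
  let K : Type w := { S : Set J // DirectedOn (· ≤ ·) S ∧ S.Nonempty ∧ HasCardinalLT S κ }
  let A : K → Set J := Subtype.val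
  have hA : Monotone A := fun _ _ h ↦ h
  obtain ⟨m, hl, hr⟩ := exists_upper_bound_op J
  have hcl (S : Set J) (hS : S.Nonempty) (hS' : HasCardinalLT S κ) : ∃ k : K, S ⊆ A k :=
    ⟨⟨opClosure m S, directedOn_opClosure hl hr S, hS.mono (subset_opClosure m S),
      hasCardinalLT_opClosure m S hκ hS'⟩, subset_opClosure m S⟩
  have : IsCardinalFiltered K κ := isCardinalFiltered_preorder _ _ fun ι s hι ↦ by
    -- Keeps the union nonempty when the family is empty.
    let j₀ : J := Classical.arbitrary J
    obtain ⟨k, hk⟩ := hcl ((⋃ i, A (s i)) ∪ {j₀}) ⟨j₀, Or.inr rfl⟩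
      (hasCardinalLT_union hreg.aleph0_le (hasCardinalLT_iUnion _
        ((hasCardinalLT_iff_cardinal_mk_lt _ _).2 hι) fun i ↦ (s i).2.2.2)
        (hasCardinalLT_of_finite _ _ hreg.aleph0_le))
    exact ⟨k, fun i ↦ (Set.subset_iUnion (fun i ↦ A (s i)) i).trans
      (Set.subset_union_left.trans hk)⟩
  have := isFiltered_of_isCardinalFiltered K κ
  have : IsDirectedOrder K := IsFiltered.isDirectedOrder K
  have (k : K) : HasColimit (restrictDiagram D (A k)) := by
    have := k.2.1.isDirectedOrder
    have := k.2.2.1.to_subtype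
    have := hC (A k)
    infer_instance
  obtain ⟨hcol⟩ := nonempty_isColimit_subsetColimitCocone D hA
    (Set.eq_univ_of_forall fun j ↦ by
      obtain ⟨k, hk⟩ := hcl {j} ⟨j, rfl⟩ (hasCardinalLT_of_finite _ _ hreg.aleph0_le)
      exact Set.mem_iUnion.2 ⟨k, hk rfl⟩) hc
  obtain ⟨k, s, hs⟩ := IsCardinalPresentable.exists_hom_of_isColimit κ hcol (𝟙 c.pt)
  exact ⟨A k, k.2.1, k.2.2.1, k.2.2.2, inferInstance, s, hs⟩

/-- A `κ`-presentable directed colimit of finitely presentable objects is the colimit over a directed subset of cardinality `< κ`. -/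
lemma exists_isColimit_restrictCocone (hC : HasDirectedColimits.{w} C)
    {J : Type w} [PartialOrder J] [IsDirectedOrder J] [Nonempty J] {D : J ⥤ C} {c : Cocone D}
    (hc : IsColimit c) {κ : Cardinal.{w}} (hκ : ℵ₀ < κ) (hX : IsPresentableAt c.pt κ)
    (hD : ∀ j, IsPresentableAt (D.obj j) (ℵ₀ : Cardinal.{w})) :
    ∃ S : Set J, DirectedOn (· ≤ ·) S ∧ HasCardinalLT S κ ∧
      Nonempty (IsColimit (restrictCocone c S)) := by
  obtain ⟨S, hS, hS', hSκ, _, s, hs⟩ := exists_section_subsetColimit hC hc hκ hX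
  have : Fact (ℵ₀ : Cardinal.{w}).IsRegular := ⟨isRegular_aleph0⟩
  have hDj (j : J) : IsCardinalPresentable (D.obj j) (ℵ₀ : Cardinal.{w}) := (hD j).2
  have := hS.isDirectedOrder
  have := hS'.to_subtype
  have : IsCardinalFiltered S (ℵ₀ : Cardinal.{w}) :=
    (isCardinalFiltered_aleph0_iff S).2 inferInstance
  have : IsCardinalFiltered J (ℵ₀ : Cardinal.{w}) :=
    (isCardinalFiltered_aleph0_iff J).2 inferInstance
  -- As `D.obj j` is finitely presentable and `S` is directed, `c.ι.app j ≫ s` factors through some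
  -- `D.obj x` with `x ∈ S`. The factor `g` agrees with the identity of `D.obj j` in the colimit
  -- over `J`, hence already at a stage `i`, called `φ j` below.
  have hφ (j : J) : ∃ (i : J) (x : J) (hx : x ∈ S) (a : j ⟶ i) (b : x ⟶ i)
      (g : D.obj j ⟶ D.obj x),
      g ≫ subsetColimitι D S x hx = c.ι.app j ≫ s ∧ D.map a = g ≫ D.map b := by
    obtain ⟨⟨x, hx⟩, g, hg⟩ := IsCardinalPresentable.exists_hom_of_isColimit (ℵ₀ : Cardinal.{w})
      (isColimitSubsetCocone D S) (c.ι.app j ≫ s)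
    have hg' : c.ι.app j = g ≫ c.ι.app x := calc
      c.ι.app j = c.ι.app j ≫ s ≫ subsetColimitDesc S c := by
        rw [hs]
        exact (Category.comp_id _).symm
      _ = (c.ι.app j ≫ s) ≫ subsetColimitDesc S c := (Category.assoc _ _ _).symm
      _ = (g ≫ subsetColimitι D S x hx) ≫ subsetColimitDesc S c :=
        congrArg (· ≫ subsetColimitDesc S c) hg.symm
      _ = g ≫ c.ι.app x := by rw [Category.assoc, ι_subsetColimitDesc]
    obtain ⟨i, a, b, h⟩ := IsCardinalPresentable.exists_eq_of_isColimit (ℵ₀ : Cardinal.{w})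
      hc (𝟙 (D.obj j)) g ((Category.id_comp _).trans hg')
    exact ⟨i, x, hx, a, b, g, hg, (Category.id_comp _).symm.trans h⟩
  choose φ x hx a b g hg hab using hφ
  obtain ⟨m, hl, hr⟩ := exists_upper_bound_op J
  -- Closure under this one operation yields both directedness and, for each `y`, an element above
  -- `φ y`.
  let m' : J → J → J := fun i j ↦ m (φ i) j
  have hl' (i j : J) : i ≤ m' i j := (leOfHom (a i)).trans (hl _ _)
  have hr' (i j : J) : j ≤ m' i j := hr _ _
  let T : Set J := opClosure m' S
  have hST : S ⊆ T := subset_opClosure m' S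
  have hT : DirectedOn (· ≤ ·) T := directedOn_opClosure hl' hr' S
  have : HasColimit (restrictDiagram D T) := by
    have := hT.isDirectedOrder
    have := (hS'.mono hST).to_subtype
    have := hC T
    infer_instance
  refine ⟨T, hT, hasCardinalLT_opClosure m' S hκ hSκ, ⟨?_⟩⟩
  -- The stage `φ y` identifying `g y` with the identity lies below an element of `T`, so `s`
  -- followed by the map to the colimit over `T` restricts to the coprojections, and is therefore a
  -- two-sided inverse.
  have hid (y : J) (hy : y ∈ T) :
      c.ι.app y ≫ s ≫ subsetColimitMap D hST = subsetColimitι D T y hy := by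
    have hi : m' y y ∈ T := opClosure_mem m' S hy hy
    let u : φ y ⟶ m' y y := homOfLE (hl _ _)
    calc
      c.ι.app y ≫ s ≫ subsetColimitMap D hST = (c.ι.app y ≫ s) ≫ subsetColimitMap D hST :=
        (Category.assoc _ _ _).symm
      _ = (g y ≫ subsetColimitι D S (x y) (hx y)) ≫ subsetColimitMap D hST :=
        congrArg (· ≫ subsetColimitMap D hST) (hg y).symm
      _ = g y ≫ D.map (b y ≫ u) ≫ subsetColimitι D T (m' y y) hi := by
        rw [Category.assoc, ι_subsetColimitMap,
          map_subsetColimitι D T (b y ≫ u) (hST (hx y)) hi]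
      _ = D.map (a y ≫ u) ≫ subsetColimitι D T (m' y y) hi := by
        rw [D.map_comp, D.map_comp, hab y]
        simp only [Category.assoc]
      _ = subsetColimitι D T y hy := map_subsetColimitι D T _ _ _
  let e : subsetColimit D T ≅ c.pt :=
    { hom := subsetColimitDesc T c
      inv := s ≫ subsetColimitMap D hST
      hom_inv_id := subsetColimit_hom_ext fun y hy ↦ by
        rw [← Category.assoc, ι_subsetColimitDesc, Category.comp_id]
        exact hid y hy
      inv_hom_id := by rw [Category.assoc, subsetColimitMap_desc, hs] }
  exact (isColimitSubsetCocone D T).ofIsoColimit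
    (Cocone.ext e fun y ↦ ι_subsetColimitDesc T c y.1 y.2)

end Presentability

/-! ### The three statements for accessible categories. -/

section Accessible

variable (C : Type u) [Category.{v} C]

lemma exists_directed_colimit_of_isCardinalPresentable (lam : Cardinal.{w}) [Fact lam.IsRegular]
    [IsCardinalAccessibleCategory C lam] (X : C) :
    ∃ (J : Type w) (_ : PartialOrder J) (_ : IsDirectedOrder J) (_ : Nonempty J)
      (P : ColimitPresentation J X), ∀ j, IsPresentableAt (P.diag.obj j) lam := by
  obtain ⟨J, _, _, ⟨p⟩⟩ :=
    (isCardinalFilteredGenerator_isCardinalPresentable C lam).exists_colimitsOfShape X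
  -- A final functor from a directed poset replaces the filtered index category.
  obtain ⟨α, _, _, F, _⟩ := IsCardinalFiltered.exists_cardinal_directed J lam
  have := isFiltered_of_isCardinalFiltered α lam
  exact ⟨α, inferInstance, IsFiltered.isDirectedOrder α, IsFiltered.nonempty,
    p.toColimitPresentation.reindex F, fun j ↦ ⟨inferInstance, p.prop_diag_obj (F.obj j)⟩⟩

lemma hasDirectedColimits_of_isFinitelyAccessible [IsFinitelyAccessibleCategory.{w} C] :
    HasDirectedColimits.{w} C := by
  intro J _ _ _
  have : Fact (ℵ₀ : Cardinal.{w}).IsRegular := ⟨isRegular_aleph0⟩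
  have : IsCardinalFiltered J (ℵ₀ : Cardinal.{w}) :=
    (isCardinalFiltered_aleph0_iff J).2 inferInstance
  exact HasCardinalFilteredColimits.hasColimitsOfShape C (ℵ₀ : Cardinal.{w}) J

theorem isWellFiltrableCategory_of_isFinitelyAccessible [IsFinitelyAccessibleCategory.{w} C] :
    IsWellFiltrableCategory.{w} C ℵ₁ := by
  intro κ hκ hle X hX
  have hC := hasDirectedColimits_of_isFinitelyAccessible.{w} C
  have : Fact (ℵ₀ : Cardinal.{w}).IsRegular := ⟨isRegular_aleph0⟩
  have hlt : ℵ₀ < κ := aleph0_lt_aleph_one.trans_le hle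
  obtain ⟨J, _, _, _, P, hP⟩ :=
    exists_directed_colimit_of_isCardinalPresentable C (ℵ₀ : Cardinal.{w}) X
  obtain ⟨S, hS, hS', ⟨hc⟩⟩ := exists_isColimit_restrictCocone hC P.isColimit hlt hX.1 hP
  have := hS.isDirectedOrder
  exact isFiltrable_of_isColimit hC hc isRegular_aleph0 hlt hS' (fun _ ↦ hP _) hX

theorem isAlmostWellFiltrableCategory_of_isCardinalAccessible (lam : Cardinal.{w})
    [Fact lam.IsRegular] [IsCardinalAccessibleCategory C lam] (hC : HasDirectedColimits.{w} C) :
    IsAlmostWellFiltrableCategory C (Order.succ lam) := by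
  intro κ hκ hle X hX
  have hlam : lam.IsRegular := Fact.out
  have hlt : lam < κ := Order.succ_le_iff.1 hle
  obtain ⟨J, _, _, _, P, hP⟩ := exists_directed_colimit_of_isCardinalPresentable C lam X
  obtain ⟨S, hS, hS', hSκ, _, s, hs⟩ := exists_section_subsetColimit hC P.isColimit
    (hlam.aleph0_le.trans_lt hlt) hX.1
  have hN : IsPresentableAt (subsetColimit P.diag S) κ :=
    isPresentableAt_of_isColimit (isColimitSubsetCocone P.diag S) hκ hlt.le hSκ
      (fun _ ↦ hP _)
  have := hS.isDirectedOrder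
  -- The rank of the colimit is not below `κ`, because presentability passes to its retract `X`.
  exact ⟨_, isFiltrable_of_isColimit hC (isColimitSubsetCocone P.diag S) hlam hlt
    hSκ (fun _ ↦ hP _) ⟨hN, fun θ hθ ↦ hX.2 (hθ.of_retract ⟨s, _, hs⟩)⟩, hN, _,
    IsSplitEpi.mk' ⟨s, hs⟩⟩

theorem isWellFiltrableCategory_of_mono {μ : Cardinal.{w}}
    (h : IsAlmostWellFiltrableCategory C μ) (hmono : ∀ (X Y : C) (f : X ⟶ Y), Mono f) :
    IsWellFiltrableCategory C μ := by
  intro κ hκ hle X hX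
  obtain ⟨N, hN, -, p, _⟩ := h κ hκ hle X hX
  have := hmono _ _ p
  have := isIso_of_mono_of_isSplitEpi p
  exact hN.of_iso (asIso p)

end Accessible

end Filtrations

theorem mainTheorem8 (C : Type u) [Category.{v} C] :
    (IsFinitelyAccessibleCategory.{w} C →
      Filtrations.IsWellFiltrableCategory.{w} C ℵ₁) ∧
    (∀ (lam : Cardinal.{w}) [Fact lam.IsRegular], IsCardinalAccessibleCategory C lam →
      Filtrations.HasDirectedColimits.{w} C →
        Filtrations.IsAlmostWellFiltrableCategory C (Order.succ lam)) ∧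
    (∀ (lam : Cardinal.{w}) [Fact lam.IsRegular], IsCardinalAccessibleCategory C lam →
      Filtrations.HasDirectedColimits.{w} C →
        (∀ (X Y : C) (f : X ⟶ Y), Mono f) →
          Filtrations.IsWellFiltrableCategory C (Order.succ lam)) :=
  ⟨fun _ ↦ Filtrations.isWellFiltrableCategory_of_isFinitelyAccessible C,
    fun lam _ _ hC ↦ Filtrations.isAlmostWellFiltrableCategory_of_isCardinalAccessible C lam hC,
    fun lam _ _ hC hmono ↦ Filtrations.isWellFiltrableCategory_of_mono C
      (Filtrations.isAlmostWellFiltrableCategory_of_isCardinalAccessible C lam hC) hmono⟩
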